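/- For a group $G$, the power graph $\mathcal{P}(G)$ is the simple graph with vertex set $G$ in which two distinct vertices $u,v$ are adjacent if and only if $u=v^k$ or $v=u^l$ for some positive integers $k,l$. For a finite simple graph $\Gamma$, the vertex connectivity $\kappa(\Gamma)$ is the minimum number of vertices whose deletion gives a disconnected graph or a graph with a single vertex, and $\delta(\Gamma)$ is the minimum degree of $\Gamma$. A maximal cyclic subgroup of a group is a cyclic subgroup that is not properly contained in any cyclic subgroup of that group. **Theorem 1.4.** Let $G$ be a finite nilpotent group. Then $\kappa(\mathcal{P}(G))=\delta(\mathcal{P}(G))$ if and only if one of the following holds: 1. $G$ is cyclic and $|G|=p^a$ or $|G|=2p^a$ for some prime $p$ and some integer $a\ge 0$. 2. $G$ is noncyclic of order $2^s p^t$, where $p$ is an odd prime and $s\ge 2$, $t\ge 0$ are integers, such that - (i) the Sylow $2$-subgroup of $G$ is noncyclic and has a maximal cyclic subgroup of order $2$; - (ii) the Sylow $p$-subgroup of $G$ is cyclic (and it is trivial if $t=0$). -/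

import Mathlib

/-- The power graph of a group: the simple graph on the elements of `G` in which two distinct
vertices are adjacent when one of them is a positive power of the other. -/
def powerGraph (G : Type*) [Group G] : SimpleGraph G where
  Adj u v := u ≠ v ∧ ((∃ k : ℕ, 0 < k ∧ u = v ^ k) ∨ (∃ l : ℕ, 0 < l ∧ v = u ^ l))
  symm := ⟨fun _ _ h => ⟨h.1.symm, h.2.symm⟩⟩
  loopless := ⟨fun _ h => h.1 rfl⟩

/-- The vertex connectivity of a finite graph: the least number of vertices whose deletion leaves
a disconnected graph or a trivial (one-vertex) graph. For a nonempty vertex set such a deletion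
always exists (delete all vertices but one), so the infimum is a minimum. -/
noncomputable def vertexConnectivity {V : Type*} [Finite V] (Γ : SimpleGraph V) : ℕ :=
  sInf {k : ℕ | ∃ S : Finset V, S.card = k ∧
    (¬ (Γ.induce ((S : Set V)ᶜ)).Preconnected ∨ ∃ v : V, (S : Set V)ᶜ = {v})}

/-- A maximal cyclic subgroup: a cyclic subgroup that is not properly contained in any
cyclic subgroup. -/
def IsMaximalCyclic {H : Type*} [Group H] (M : Subgroup H) : Prop :=
  IsCyclic M ∧ ∀ N : Subgroup H, IsCyclic N → ¬ M < N

/-! Let `x` have minimum degree. If `x` is adjacent to every other vertex, the power graph is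
complete, which forces `G` to be cyclic of prime power order. Otherwise, deleting only the
neighbours of `x` that do not generate ⟨x⟩ already disconnects the graph, so κ = δ makes `x` the
sole generator of ⟨x⟩, hence an involution; a square root of `x` would also have minimum degree but
order 4, so `x` is not a square.

Nilpotency gives G = P × H with P a 2-group and |H| odd. As `x` is a nonsquare, it is a power of
exactly the elements of xH, whence deg x = |H| (`degree_eq_natCard`). Cuts around the vertices xh
(`card_nonneighbors_le`) then force H to be cyclic of prime power order.

Conversely, if the cyclic subgroups of H form a chain, then after fewer than |H| deletions each a ∈
P still has an intact pair h, ah; these pairs tie the graph together, so κ ≥ |H| = deg x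
(`natCard_le_vertexConnectivity`). Nonsquare involutions are exactly the generators of maximal
cyclic subgroups of order 2 in P; when P is cyclic this means |P| = 2. -/

open Subgroup

/-! ### General bounds on vertex connectivity. -/

section Connectivity

variable {V : Type*} (Γ : SimpleGraph V)

/-- A walk avoiding `S` that starts in `C` can never leave `C`. -/
theorem vertexConnectivity_le_card_of_separates [Finite V] {C : Set V} {S : Finset V} {u w : V}
    (hu : u ∈ C) (huS : u ∉ S) (hw : w ∉ C) (hwS : w ∉ S)
    (hN : ∀ a ∈ C, ∀ b, Γ.Adj a b → b ∉ S → b ∈ C) :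
    vertexConnectivity Γ ≤ S.card := by
  refine Nat.sInf_le ⟨S, rfl, Or.inl fun hpre => hw ?_⟩
  obtain ⟨p⟩ := hpre ⟨u, by simpa using huS⟩ ⟨w, by simpa using hwS⟩
  have key : ∀ (a b : ((S : Set V)ᶜ : Set V)), (Γ.induce ((S : Set V)ᶜ)).Walk a b →
      (a : V) ∈ C → (b : V) ∈ C := by
    intro a b p
    induction p with
    | nil => exact id
    | @cons _ b _ h _ ih => exact fun ha => ih (hN _ ha _ h (fun hb => b.2 (Finset.mem_coe.2 hb)))
  exact key _ _ p hu

theorem vertexConnectivity_le_minDegree [Fintype V] [Nonempty V] [DecidableRel Γ.Adj] :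
    vertexConnectivity Γ ≤ Γ.minDegree := by
  obtain ⟨v, hv⟩ := Γ.exists_minimal_degree_vertex
  rw [hv, ← SimpleGraph.card_neighborFinset_eq_degree]
  by_cases h : ∃ w, w ≠ v ∧ ¬ Γ.Adj v w
  · obtain ⟨w, hwv, hw⟩ := h
    refine vertexConnectivity_le_card_of_separates Γ (C := {v}) (u := v) (w := w) rfl ?_ hwv ?_ ?_
    · simp
    · simpa using hw
    · rintro a rfl b hab hb
      simp [hab] at hb
  -- A dominating vertex cannot be isolated; deleting all its neighbours leaves a single vertex
  -- instead.
  · push Not at h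
    refine Nat.sInf_le ⟨_, rfl, Or.inr ⟨v, ?_⟩⟩
    ext w
    simp only [SimpleGraph.coe_neighborFinset, Set.mem_compl_iff, SimpleGraph.mem_neighborSet,
      Set.mem_singleton_iff]
    exact ⟨fun hw => by_contra fun hwv => hw (h w hwv), by rintro rfl; simp⟩

/-- `hcard` disposes of the one-vertex clause: leaving one vertex costs |V| - 1 ≥ k deletions. -/
theorem le_vertexConnectivity [Finite V] [Nonempty V] {k : ℕ}
    (hcard : k < Nat.card V)
    (h : ∀ S : Finset V, S.card < k → (Γ.induce ((S : Set V)ᶜ)).Preconnected) :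
    k ≤ vertexConnectivity Γ := by
  classical
  have := Fintype.ofFinite V
  refine le_csInf ⟨(Finset.univ.erase (Classical.arbitrary V)).card, _, rfl, Or.inr
    ⟨Classical.arbitrary V, ?_⟩⟩ ?_
  · ext; simp
  · rintro _ ⟨S, rfl, hS⟩
    by_contra! hlt
    obtain hS | ⟨v, hv⟩ := hS
    · exact hS (h S hlt)
    · have h1 : Sᶜ = {v} := by
        rw [← Finset.coe_inj]; simpa using hv
      have h2 := Finset.card_compl S
      rw [h1, Finset.card_singleton] at h2
      rw [Nat.card_eq_fintype_card] at hcard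
      omega

end Connectivity

theorem powerGraph_adj_iff {G : Type*} [Group G] [Finite G] {u v : G} :
    (powerGraph G).Adj u v ↔ u ≠ v ∧ (u ∈ zpowers v ∨ v ∈ zpowers u) := by
  have key : ∀ u v : G, (∃ k : ℕ, 0 < k ∧ u = v ^ k) ↔ u ∈ zpowers v := by
    intro u v
    constructor
    · rintro ⟨k, -, rfl⟩
      exact npow_mem_zpowers v k
    · intro h
      rw [← mem_powers_iff_mem_zpowers] at h
      obtain ⟨k, rfl⟩ := h
      -- The exponent `k` may be 0; adding the order makes it positive.
      exact ⟨k + orderOf v, by have := orderOf_pos v; omega, by simp [pow_add]⟩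
  simp only [powerGraph, key]

/-! ### Splitting off the Sylow 2-subgroup of a nilpotent group. -/

section GroupTheory

variable {G : Type*} [Group G]

/-- Raising `a * b` to the order of `b` kills `b` and, by coprimality, leaves a generator of ⟨a⟩. -/
theorem Commute.left_mem_zpowers_mul {a b : G} (hab : Commute a b)
    (h : (orderOf a).Coprime (orderOf b)) : a ∈ zpowers (a * b) := by
  have h1 : (a * b) ^ orderOf b = a ^ orderOf b := by
    rw [hab.mul_pow, pow_orderOf_eq_one, mul_one]
  obtain ⟨m, hm⟩ := exists_pow_eq_self_of_coprime (x := a) h.symm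
  have h2 : ((a * b) ^ orderOf b) ^ m ∈ zpowers (a * b) := pow_mem (pow_mem (mem_zpowers _) _) _
  rwa [h1, hm] at h2

theorem Commute.right_mem_zpowers_mul {a b : G} (hab : Commute a b)
    (h : (orderOf a).Coprime (orderOf b)) : b ∈ zpowers (a * b) := by
  rw [hab.eq]
  exact hab.symm.left_mem_zpowers_mul h.symm

/-- The complement is the kernel of the projection onto the Sylow 2-factor. An element of order 2
there would be trivial in the 2-factor by definition and in the other factors by coprimality. -/
theorem exists_odd_complement_sylow_two [Finite G] [Group.IsNilpotent G]
    (h2 : 2 ∣ Nat.card G) (P : Sylow 2 G) :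
    ∃ H : Subgroup G, Odd (Nat.card H) ∧ IsComplement' (P : Subgroup G) H ∧
      ∀ a ∈ P, ∀ h ∈ H, Commute a h := by
  obtain ⟨e⟩ := ((Group.isNilpotent_of_finite_tfae (G := G)).out 0 4).mp ‹_›
  let two : (Nat.card G).primeFactors := ⟨2, by simp [Nat.prime_two, h2, Nat.card_pos.ne']⟩
  let f : G →* P :=
    ((Pi.evalMonoidHom (fun Q : Sylow 2 G => Q) P).comp
      (Pi.evalMonoidHom (fun p : (Nat.card G).primeFactors => ∀ Q : Sylow p G, Q) two)).comp
      e.symm.toMonoidHom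
  have hsub : Subsingleton (Sylow 2 G) := ⟨fun A B => Sylow.ext <| by
    have hA : (A : Subgroup G) ≤ B := A.isPGroup'.le_sylow_of_normal B
    have hB : (B : Subgroup G) ≤ A := B.isPGroup'.le_sylow_of_normal A
    exact le_antisymm hA hB⟩
  have hodd : Odd (Nat.card f.ker) := by
    rw [← Nat.not_even_iff_odd, even_iff_two_dvd]
    intro hd
    obtain ⟨y, hy⟩ := exists_prime_orderOf_dvd_card' 2 hd
    have hy2 : (y : G) ^ 2 = 1 := congrArg Subtype.val (orderOf_dvd_iff_pow_eq_one.1 hy.dvd)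
    have hz : e.symm y = 1 := by
      funext p Q
      by_cases hp : p = two
      · subst hp
        obtain rfl : Q = P := Subsingleton.elim (α := Sylow 2 G) _ _
        exact y.2
      · have : Fact (p : ℕ).Prime := ⟨Nat.prime_of_mem_primeFactors p.2⟩
        have hp2 : (p : ℕ).Coprime 2 := (Nat.coprime_primes this.out Nat.prime_two).2
          fun h => hp (Subtype.ext h)
        have hc := Q.isPGroup'.orderOf_coprime hp2 (e.symm (y : G) p Q)
        have hd : (e.symm (y : G) p Q) ^ 2 = 1 := by
          have : (e.symm (y : G)) ^ 2 = 1 := by rw [← map_pow, hy2, map_one]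
          exact congrFun (congrFun this p) Q
        exact orderOf_eq_one_iff.1 (Nat.eq_one_of_dvd_coprimes hc dvd_rfl
          (orderOf_dvd_of_pow_eq_one hd))
    have : (y : G) = 1 := by simpa using hz
    rw [orderOf_eq_one_iff.2 (Subtype.ext this)] at hy
    omega
  obtain ⟨n, hn⟩ := P.isPGroup'.exists_card_eq
  have hcop : (Nat.card P).Coprime (Nat.card f.ker) := by
    rw [hn]
    exact (Nat.coprime_two_left.2 hodd).pow_left n
  have hcard : Nat.card P * Nat.card f.ker = Nat.card G := by
    rw [← f.ker.index_mul_card]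
    congr 1
    apply Nat.dvd_antisymm
    · apply hcop.dvd_of_dvd_mul_right
      rw [f.ker.index_mul_card]
      exact Subgroup.card_subgroup_dvd_card _
    · rw [Subgroup.index_ker]
      exact Subgroup.card_subgroup_dvd_card _
  have hcompl : IsComplement' (P : Subgroup G) f.ker := isComplement'_of_coprime hcard hcop
  exact ⟨f.ker, hodd, hcompl, fun a ha h hh => commute_of_normal_of_disjoint _ _ inferInstance
    inferInstance hcompl.disjoint a h ha hh⟩

end GroupTheory

/-- A decomposition of a finite group as the internal direct product of a `2`-subgroup and a
subgroup of odd order. -/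
structure IsTwoDecomposition {G : Type*} [Group G] (P H : Subgroup G) : Prop where
  isPGroup : IsPGroup 2 P
  odd : Odd (Nat.card H)
  isComplement : IsComplement' P H
  commute : ∀ a ∈ P, ∀ h ∈ H, Commute a h

/-! ### Coordinates in P × H and nonsquare involutions. -/

namespace IsTwoDecomposition

variable {G : Type*} [Group G] {P H : Subgroup G}

theorem exists_mul_eq (d : IsTwoDecomposition P H) (g : G) : ∃ a ∈ P, ∃ h ∈ H, a * h = g := by
  obtain ⟨⟨⟨a, ha⟩, ⟨h, hh⟩⟩, hg⟩ := d.isComplement.2 g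
  exact ⟨a, ha, h, hh, hg⟩

theorem mul_inj (d : IsTwoDecomposition P H) {a b h k : G} (ha : a ∈ P) (hb : b ∈ P) (hh : h ∈ H)
    (hk : k ∈ H) (e : a * h = b * k) : a = b ∧ h = k := by
  have := d.isComplement.1 (a₁ := (⟨a, ha⟩, ⟨h, hh⟩)) (a₂ := (⟨b, hb⟩, ⟨k, hk⟩)) e
  simpa using this

theorem odd_orderOf (d : IsTwoDecomposition P H) {h : G} (hh : h ∈ H) : Odd (orderOf h) := by
  refine d.odd.of_dvd_nat ?_
  rw [← Subgroup.orderOf_mk h hh]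
  exact orderOf_dvd_natCard _

theorem exists_pow_eq_one (d : IsTwoDecomposition P H) {a : G} (ha : a ∈ P) :
    ∃ k : ℕ, a ^ 2 ^ k = 1 := by
  obtain ⟨k, hk⟩ := d.isPGroup ⟨a, ha⟩
  exact ⟨k, congrArg Subtype.val hk⟩

theorem coprime (d : IsTwoDecomposition P H) {a h : G} (ha : a ∈ P) (hh : h ∈ H) :
    (orderOf a).Coprime (orderOf h) := by
  obtain ⟨k, hk⟩ := d.exists_pow_eq_one ha
  exact ((Nat.coprime_two_left.2 (d.odd_orderOf hh)).pow_left k).coprime_dvd_left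
    (orderOf_dvd_of_pow_eq_one hk)

theorem mem_left_of_pow_eq_one (d : IsTwoDecomposition P H) {y : G} {k : ℕ} (hy : y ^ 2 ^ k = 1) :
    y ∈ P := by
  obtain ⟨a, ha, h, hh, rfl⟩ := d.exists_mul_eq y
  rw [(d.commute a ha h hh).mul_pow] at hy
  have h1 := (d.mul_inj (pow_mem ha _) (one_mem P) (pow_mem hh _) (one_mem H)
    (hy.trans (mul_one 1).symm)).2
  have h2 := Nat.eq_one_of_dvd_coprimes ((Nat.coprime_two_left.2 (d.odd_orderOf hh)).pow_left k)
    (orderOf_dvd_of_pow_eq_one h1) dvd_rfl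
  rw [orderOf_eq_one_iff.1 h2, mul_one]
  exact ha

theorem mem_right_of_pow_eq_one (d : IsTwoDecomposition P H) {y : G} {m : ℕ} (hm : Odd m)
    (hy : y ^ m = 1) : y ∈ H := by
  obtain ⟨a, ha, h, hh, rfl⟩ := d.exists_mul_eq y
  rw [(d.commute a ha h hh).mul_pow] at hy
  have h1 := (d.mul_inj (pow_mem ha _) (one_mem P) (pow_mem hh _) (one_mem H)
    (hy.trans (mul_one 1).symm)).1
  obtain ⟨k, hk⟩ := d.exists_pow_eq_one ha
  have h2 := Nat.eq_one_of_dvd_coprimes ((Nat.coprime_two_left.2 hm).pow_left k)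
    (orderOf_dvd_of_pow_eq_one hk) (orderOf_dvd_of_pow_eq_one h1)
  rw [orderOf_eq_one_iff.1 h2, one_mul]
  exact hh

/-- Coprimality of the orders makes ⟨bk⟩ contain both `b` and `k`, so the power relation can be
checked coordinatewise. -/
theorem mul_mem_zpowers_mul_iff (d : IsTwoDecomposition P H) {a b h k : G} (ha : a ∈ P)
    (hb : b ∈ P) (hh : h ∈ H) (hk : k ∈ H) :
    a * h ∈ zpowers (b * k) ↔ a ∈ zpowers b ∧ h ∈ zpowers k := by
  have hbk := d.commute b hb k hk
  constructor
  · rintro ⟨n, hn⟩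
    simp only [hbk.mul_zpow] at hn
    obtain ⟨rfl, rfl⟩ := d.mul_inj (zpow_mem hb n) ha (zpow_mem hk n) hh hn
    exact ⟨zpow_mem (mem_zpowers b) n, zpow_mem (mem_zpowers k) n⟩
  · rintro ⟨h1, h2⟩
    exact mul_mem (zpowers_le.2 (hbk.left_mem_zpowers_mul (d.coprime hb hk)) h1)
      (zpowers_le.2 (hbk.right_mem_zpowers_mul (d.coprime hb hk)) h2)

theorem isCyclic (d : IsTwoDecomposition P H) (hP : IsCyclic P) (hH : IsCyclic H) :
    IsCyclic G := by
  obtain ⟨b, rfl⟩ := (Subgroup.isCyclic_iff_exists_zpowers_eq_top P).1 hP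
  obtain ⟨k, rfl⟩ := (Subgroup.isCyclic_iff_exists_zpowers_eq_top H).1 hH
  refine ⟨b * k, fun g => ?_⟩
  obtain ⟨a, ha, h, hh, rfl⟩ := d.exists_mul_eq g
  exact (d.mul_mem_zpowers_mul_iff ha (mem_zpowers b) hh (mem_zpowers k)).2 ⟨ha, hh⟩

variable {x : G}

theorem mem_left_of_orderOf_eq_two (d : IsTwoDecomposition P H) (hx : orderOf x = 2) : x ∈ P :=
  d.mem_left_of_pow_eq_one (k := 1) (by rw [pow_one, ← hx, pow_orderOf_eq_one])

/-- An involution that is not a square generates a maximal cyclic subgroup of the `2`-part. -/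
theorem eq_of_mem_zpowers (d : IsTwoDecomposition P H) (hx : orderOf x = 2)
    (hsq : ∀ y : G, y ^ 2 ≠ x) {b : G} (hb : b ∈ P) (hxb : x ∈ zpowers b) : b = x := by
  obtain ⟨k, hk⟩ := d.exists_pow_eq_one hb
  have hfin : IsOfFinOrder b := isOfFinOrder_iff_pow_eq_one.2 ⟨2 ^ k, by positivity, hk⟩
  rw [← hfin.mem_powers_iff_mem_zpowers] at hxb
  obtain ⟨n, rfl⟩ := hxb
  simp only at hx hsq ⊢
  -- An even power of `b` is a square. An odd power has the same order as `b`, so `b` has order 2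
  -- and equals its odd powers.
  obtain ⟨m, rfl⟩ | hn := n.even_or_odd
  · exact absurd (by rw [← pow_mul, mul_two]) (hsq (b ^ m))
  · have hc : n.Coprime (orderOf b) := (((Nat.coprime_two_left.2 hn).pow_left k).coprime_dvd_left
      (orderOf_dvd_of_pow_eq_one hk)).symm
    have hb2 : orderOf b = 2 := by rw [← hx, Nat.Coprime.orderOf_pow hc.symm]
    obtain ⟨m, rfl⟩ := hn
    rw [pow_succ, pow_mul, ← hb2, pow_orderOf_eq_one, one_pow, one_mul]

end IsTwoDecomposition

/-! ### Vertices of minimum degree when κ = δ. -/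

section Cuts

variable {G : Type*} [Group G] [Fintype G]

/-- Deleting the neighbours of `v` that do not generate the same cyclic subgroup as `v` isolates
the set of generators of that subgroup. -/
theorem vertexConnectivity_powerGraph_le_card {v w : G} (hwv : w ≠ v)
    (hw : ¬ (powerGraph G).Adj v w) (S : Finset G)
    (hS : ∀ g, g ∈ S ↔ (powerGraph G).Adj v g ∧ zpowers g ≠ zpowers v) :
    vertexConnectivity (powerGraph G) ≤ S.card := by
  have hne : zpowers w ≠ zpowers v := fun h =>
    hw (powerGraph_adj_iff.2 ⟨hwv.symm, Or.inr (h ▸ mem_zpowers w)⟩)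
  refine vertexConnectivity_le_card_of_separates _ (C := {g | zpowers g = zpowers v}) (u := v)
    (w := w) rfl (by simp [hS]) hne (by simp [hS, hw]) ?_
  intro a ha b hab hb
  by_contra hbv
  have ha' : zpowers a = zpowers v := ha
  refine hb ((hS b).2 ⟨powerGraph_adj_iff.2 ⟨fun h => hbv (by rw [← h]; rfl), ?_⟩, hbv⟩)
  -- Comparability depends only on the cyclic subgroups generated, so `a` may be replaced by `v`.
  have := (powerGraph_adj_iff.1 hab).2
  rwa [← zpowers_le, ← zpowers_le, ha', zpowers_le, zpowers_le] at this

variable [DecidableRel (powerGraph G).Adj]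

/-- In a power graph whose connectivity equals its minimum degree, a vertex of minimum degree
that is not joined to every other vertex is an involution. -/
theorem orderOf_eq_two_of_degree_le
    (hκ : vertexConnectivity (powerGraph G) = (powerGraph G).minDegree) {v w : G}
    (hv : (powerGraph G).degree v ≤ (powerGraph G).minDegree) (hwv : w ≠ v)
    (hw : ¬ (powerGraph G).Adj v w) : orderOf v = 2 := by
  classical
  refine orderOf_eq_prime ?_ ?_
  · by_contra hsq
    -- The neighbour `v⁻¹` generates ⟨v⟩, so it is spared and the cut is smaller than the degree.
    have hinv : v⁻¹ ≠ v := fun h => hsq (by rw [sq]; nth_rewrite 1 [← h]; simp)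
    have h1 := vertexConnectivity_powerGraph_le_card hwv hw
      (((powerGraph G).neighborFinset v).filter fun g => zpowers g ≠ zpowers v) (by simp)
    have h2 : (((powerGraph G).neighborFinset v).filter fun g => zpowers g ≠ zpowers v).card
        < ((powerGraph G).neighborFinset v).card := by
      refine Finset.card_lt_card (Finset.filter_ssubset.2 ⟨v⁻¹, ?_, ?_⟩)
      · rw [SimpleGraph.mem_neighborFinset, powerGraph_adj_iff]
        exact ⟨hinv.symm, Or.inr (inv_mem (mem_zpowers v))⟩
      · simp
    rw [SimpleGraph.card_neighborFinset_eq_degree] at h2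
    omega
  · rintro rfl
    exact hw (powerGraph_adj_iff.2 ⟨hwv.symm, Or.inl (one_mem _)⟩)

/-- Such an involution is not a square: a square root would have its closed neighbourhood
contained in that of the involution. -/
theorem sq_ne_of_degree_le
    (hκ : vertexConnectivity (powerGraph G) = (powerGraph G).minDegree) {v w : G}
    (hv : (powerGraph G).degree v ≤ (powerGraph G).minDegree) (hwv : w ≠ v)
    (hw : ¬ (powerGraph G).Adj v w) (y : G) : y ^ 2 ≠ v := by
  classical
  rintro rfl
  have h2 := orderOf_eq_two_of_degree_le hκ hv hwv hw
  have hy2 : y ^ 2 ≠ 1 := fun h => by rw [h, orderOf_one] at h2; omega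
  have hy4 : y ^ 4 = 1 := by
    rw [show 4 = 2 * 2 from rfl, pow_mul, ← orderOf_dvd_iff_pow_eq_one, h2]
  have hord : orderOf y = 4 := orderOf_eq_prime_pow (p := 2) (n := 1) (by simpa using hy2) hy4
  have hmem : y ^ 2 ∈ zpowers y := npow_mem_zpowers y 2
  have hsub : insert y ((powerGraph G).neighborFinset y) ⊆
      insert (y ^ 2) ((powerGraph G).neighborFinset (y ^ 2)) := by
    intro g hg
    simp only [Finset.mem_insert, SimpleGraph.mem_neighborFinset, powerGraph_adj_iff] at hg ⊢
    by_cases hgy : g = y ^ 2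
    · exact Or.inl hgy
    refine Or.inr ⟨Ne.symm hgy, ?_⟩
    obtain rfl | ⟨-, hg | hg⟩ := hg
    · exact Or.inl hmem
    · exact Or.inl (zpowers_le.2 hg hmem)
    · rw [← mem_powers_iff_mem_zpowers, mem_powers_iff_mem_range_orderOf, hord] at hg
      simp only [Finset.mem_image, Finset.mem_range] at hg
      obtain ⟨n, hn, rfl⟩ := hg
      interval_cases n
      · exact Or.inr (by simp)
      · exact Or.inl (by simp)
      · exact absurd rfl hgy
      · refine Or.inl ⟨2, ?_⟩
        change (y ^ 3) ^ (2 : ℤ) = y ^ 2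
        rw [show (2 : ℤ) = ((2 : ℕ) : ℤ) from rfl, zpow_natCast, ← pow_mul,
          show 3 * 2 = 4 + 2 from rfl, pow_add, hy4, one_mul]
  have hcard := Finset.card_le_card hsub
  rw [Finset.card_insert_of_notMem (by simp), Finset.card_insert_of_notMem (by simp),
    SimpleGraph.card_neighborFinset_eq_degree, SimpleGraph.card_neighborFinset_eq_degree] at hcard
  have hwy : w ≠ y := by
    rintro rfl
    exact hw (powerGraph_adj_iff.2 ⟨hwv.symm, Or.inl hmem⟩)
  have hw' : ¬ (powerGraph G).Adj y w := by
    intro h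
    have : w ∈ insert y ((powerGraph G).neighborFinset y) := by simp [h]
    have := hsub this
    simp [hwv, hw] at this
  -- By the inclusion of closed neighbourhoods `y` has minimum degree too, so its order would be 2
  -- rather than 4.
  have := orderOf_eq_two_of_degree_le hκ (v := y) (by omega) hwy hw'
  omega

end Cuts

/-! ### The degree of the involution and the cuts around x * h. -/

namespace IsTwoDecomposition

variable {G : Type*} [Group G] {P H : Subgroup G} {x : G}

theorem mem_zpowers_iff_exists (d : IsTwoDecomposition P H) (hx : orderOf x = 2)
    (hsq : ∀ y : G, y ^ 2 ≠ x) {g : G} : x ∈ zpowers g ↔ ∃ h ∈ H, x * h = g := by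
  have hxP := d.mem_left_of_orderOf_eq_two hx
  constructor
  · intro hg
    obtain ⟨a, ha, h, hh, rfl⟩ := d.exists_mul_eq g
    rw [← mul_one x, d.mul_mem_zpowers_mul_iff hxP ha (one_mem H) hh] at hg
    exact ⟨h, hh, by rw [d.eq_of_mem_zpowers hx hsq ha hg.1]⟩
  · rintro ⟨h, hh, rfl⟩
    have := (d.mul_mem_zpowers_mul_iff hxP hxP (one_mem H) hh).2 ⟨mem_zpowers x, one_mem _⟩
    rwa [mul_one] at this

theorem degree_eq_natCard [Fintype G] [DecidableRel (powerGraph G).Adj] (d : IsTwoDecomposition P H)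
    (hx : orderOf x = 2) (hsq : ∀ y : G, y ^ 2 ≠ x) :
    (powerGraph G).degree x = Nat.card H := by
  classical
  have hxP := d.mem_left_of_orderOf_eq_two hx
  have hx1 : x ≠ 1 := by rintro rfl; simp at hx
  have hzx : ∀ g, g ∈ zpowers x → g = 1 ∨ g = x := by
    intro g hg
    rw [← mem_powers_iff_mem_zpowers, mem_powers_iff_mem_range_orderOf, hx] at hg
    simp only [Finset.mem_image, Finset.mem_range] at hg
    obtain ⟨n, hn, rfl⟩ := hg
    interval_cases n <;> simp
  -- The closed neighbourhood of `x` is xH together with 1, of size |H| + 1.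
  have key : insert x ((powerGraph G).neighborFinset x) =
      insert 1 ((Finset.univ.filter (· ∈ H)).image (x * ·)) := by
    ext g
    simp only [Finset.mem_insert, SimpleGraph.mem_neighborFinset, powerGraph_adj_iff,
      Finset.mem_image, Finset.mem_filter, Finset.mem_univ, true_and,
      d.mem_zpowers_iff_exists hx hsq]
    constructor
    · rintro (rfl | ⟨-, h | h⟩)
      · exact Or.inr ⟨1, one_mem H, mul_one _⟩
      · exact Or.inr h
      · obtain rfl | rfl := hzx g h
        · exact Or.inl rfl
        · exact Or.inr ⟨1, one_mem H, mul_one _⟩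
    · intro h
      by_cases hg : g = x
      · exact Or.inl hg
      · refine Or.inr ⟨Ne.symm hg, ?_⟩
        obtain rfl | h := h
        · exact Or.inr (one_mem _)
        · exact Or.inl h
  have hcard := congrArg Finset.card key
  rw [Finset.card_insert_of_notMem (by simp), Finset.card_insert_of_notMem,
    Finset.card_image_of_injective _ (mul_right_injective x),
    SimpleGraph.card_neighborFinset_eq_degree] at hcard
  · rw [Nat.card_eq_fintype_card, Fintype.card_subtype]
    omega
  · simp only [Finset.mem_image, Finset.mem_filter, Finset.mem_univ, true_and, not_exists, not_and]
    intro h hh he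
    exact hx1 (d.mul_inj hxP (one_mem P) hh (one_mem H) (he.trans (mul_one 1).symm)).1

/-- If the connectivity is at least the order of the odd part, then no element of the odd part has
more non-neighbours there than its cyclic subgroup has non-generators. -/
theorem card_nonneighbors_le [Fintype G] (d : IsTwoDecomposition P H)
    (hκ : Nat.card H ≤ vertexConnectivity (powerGraph G)) (hx : orderOf x = 2)
    (hsq : ∀ y : G, y ^ 2 ≠ x) {h : G} (hh : h ∈ H) :
    Nat.card {k : G // k ∈ H ∧ k ∉ zpowers h ∧ h ∉ zpowers k} ≤
      Nat.card {u : G // u ∈ zpowers h ∧ h ∉ zpowers u} := by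
  classical
  simp only [Nat.card_eq_fintype_card, Fintype.card_subtype] at hκ ⊢
  have hxP := d.mem_left_of_orderOf_eq_two hx
  have hx1 : x ≠ 1 := by rintro rfl; simp at hx
  set N := Finset.univ.filter fun k : G => k ∈ H ∧ k ∉ zpowers h ∧ h ∉ zpowers k with hN
  set D := Finset.univ.filter fun u : G => u ∈ zpowers h ∧ h ∉ zpowers u with hD
  obtain hN0 | ⟨z, hz⟩ := N.eq_empty_or_nonempty
  -- A non-neighbour `z` of `h` in `H` is also a non-neighbour of `x * h`; it is the vertex to be
  -- separated from `x * h`.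
  · simp [hN0]
  obtain ⟨hzH, hz1, hz2⟩ : z ∈ H ∧ z ∉ zpowers h ∧ h ∉ zpowers z := by simpa [hN] using hz
  set E := Finset.univ.filter fun u : G => u ∈ zpowers h ∧ h ∈ zpowers u with hE
  set T := Finset.univ.filter fun u : G => u ∈ H ∧ (u ∈ zpowers h ∨ h ∈ zpowers u) ∧
    ¬ (u ∈ zpowers h ∧ h ∈ zpowers u) with hT
  have hhH : zpowers h ≤ H := zpowers_le.2 hh
  have hsum1 : D.card + E.card = (Finset.univ.filter (· ∈ zpowers h)).card := by
    rw [← Finset.card_union_of_disjoint]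
    · congr 1; ext u; simp [hD, hE]; tauto
    · rw [Finset.disjoint_left]; intro u; simp [hD, hE]; tauto
  have hsum2 : T.card + (N.card + E.card) = (Finset.univ.filter (· ∈ H)).card := by
    rw [← Finset.card_union_of_disjoint, ← Finset.card_union_of_disjoint]
    · congr 1; ext u
      have := @hhH u
      simp [hT, hN, hE]; tauto
    · rw [Finset.disjoint_left]; intro u; simp [hN, hE, hT]; tauto
    · rw [Finset.disjoint_left]; intro u; simp [hN, hE]; tauto
  set S := Finset.univ.filter fun g : G =>
    (powerGraph G).Adj (x * h) g ∧ zpowers g ≠ zpowers (x * h) with hS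
  have hne : ∀ {k}, k ∈ H → k ≠ x * h := fun hk e => hx1
    (d.mul_inj hxP (one_mem P) hh hk (e.symm.trans (one_mul _).symm)).1
  have hxk : ∀ {k}, k ∈ H → x * h ∉ zpowers k := by
    intro k hk hm
    rw [← one_mul k, d.mul_mem_zpowers_mul_iff hxP (one_mem P) hh hk] at hm
    exact hx1 (by simpa using hm.1)
  have hcut : vertexConnectivity (powerGraph G) ≤ S.card := by
    refine vertexConnectivity_powerGraph_le_card (hne hzH) ?_ S (by simp [hS])
    rw [powerGraph_adj_iff]
    rintro ⟨-, hm | hm⟩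
    · exact hxk hzH hm
    · rw [← one_mul z, d.mul_mem_zpowers_mul_iff (one_mem P) hxP hzH hh] at hm
      exact hz1 hm.2
  -- A deleted vertex has 2-coordinate 1 or `x`: in the first case it lies in ⟨h⟩, in the second its
  -- odd coordinate lies in `T`.
  have hSsub : S ⊆ Finset.univ.filter (· ∈ zpowers h) ∪ T.image (x * ·) := by
    intro g hg
    simp only [hS, Finset.mem_filter, Finset.mem_univ, true_and, powerGraph_adj_iff, ne_eq,
      le_antisymm_iff, zpowers_le] at hg
    obtain ⟨a, ha, k, hk, rfl⟩ := d.exists_mul_eq g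
    rw [d.mul_mem_zpowers_mul_iff hxP ha hh hk, d.mul_mem_zpowers_mul_iff ha hxP hk hh] at hg
    by_cases ha1 : a = 1
    · subst ha1
      have hk' : k ∈ zpowers h := by
        obtain ⟨-, ⟨hm, -⟩ | hm⟩ := hg.1
        · exact absurd (by simpa using hm) hx1
        · exact hm.2
      simp [hk']
    · have hax : a = x := by
        obtain ⟨-, hm | hm⟩ := hg.1
        · exact d.eq_of_mem_zpowers hx hsq ha hm.1
        · have := hm.1
          rw [← mem_powers_iff_mem_zpowers, mem_powers_iff_mem_range_orderOf, hx] at this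
          simp only [Finset.mem_image, Finset.mem_range] at this
          obtain ⟨n, hn, rfl⟩ := this
          interval_cases n
          · simp at ha1
          · simp
      subst hax
      simp only [mem_zpowers, true_and] at hg
      refine Finset.mem_union_right _ (Finset.mem_image_of_mem _ ?_)
      simp only [hT, Finset.mem_filter, Finset.mem_univ, true_and]
      exact ⟨hk, hg.1.2.symm, hg.2⟩
  have h3 := (Finset.card_le_card hSsub).trans (Finset.card_union_le _ _)
  rw [Finset.card_image_of_injective _ (mul_right_injective x)] at h3
  -- T + N + E = |H| ≤ |S| ≤ |⟨h⟩| + T = D + E + T in cardinalities, hence N ≤ D.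
  omega

end IsTwoDecomposition

/-! ### Cyclic groups and chains of cyclic subgroups. -/

section Cyclic

variable {G : Type*} [Group G] [Finite G]

/-- With n the order of `b`, a cyclic group has at most n solutions of y ^ n = 1, and ⟨b⟩ already
supplies n. -/
theorem mem_zpowers_of_orderOf_dvd [IsCyclic G] {a b : G} (h : orderOf a ∣ orderOf b) :
    a ∈ zpowers b := by
  classical
  have := Fintype.ofFinite G
  have hsub : Finset.univ.filter (· ∈ zpowers b) ⊆
      Finset.univ.filter fun y : G => y ^ orderOf b = 1 := by
    intro y hy
    simp only [Finset.mem_filter, Finset.mem_univ, true_and] at hy ⊢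
    exact orderOf_dvd_iff_pow_eq_one.1 (orderOf_dvd_of_mem_zpowers hy)
  have hcard : (Finset.univ.filter (· ∈ zpowers b)).card = orderOf b := by
    rw [← Fintype.card_zpowers, Fintype.card_subtype]
  have heq := Finset.eq_of_subset_of_card_le hsub
    (hcard.symm ▸ IsCyclic.card_pow_eq_one_le (orderOf_pos b))
  have : a ∈ Finset.univ.filter fun y : G => y ^ orderOf b = 1 := by
    simpa using orderOf_dvd_iff_pow_eq_one.1 h
  rw [← heq] at this
  simpa using this

theorem mem_zpowers_or_mem_zpowers_of_card_eq_pow [IsCyclic G] {p n : ℕ} (hp : p.Prime)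
    (h : Nat.card G = p ^ n) (a b : G) : a ∈ zpowers b ∨ b ∈ zpowers a := by
  obtain ⟨i, -, hi⟩ := (Nat.dvd_prime_pow hp).1 (h ▸ orderOf_dvd_natCard a)
  obtain ⟨j, -, hj⟩ := (Nat.dvd_prime_pow hp).1 (h ▸ orderOf_dvd_natCard b)
  obtain hij | hij := le_total i j
  · exact Or.inl (mem_zpowers_of_orderOf_dvd (by rw [hi, hj]; exact pow_dvd_pow p hij))
  · exact Or.inr (mem_zpowers_of_orderOf_dvd (by rw [hi, hj]; exact pow_dvd_pow p hij))

theorem mem_zpowers_of_orderOf_le {g a : G} (h : g ∈ zpowers a) (hle : orderOf a ≤ orderOf g) :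
    a ∈ zpowers g := by
  rw [Subgroup.eq_of_le_of_card_ge (zpowers_le.2 h) (by simpa using hle)]
  exact mem_zpowers a

theorem exists_prime_card_eq_pow
    (h : ∀ q r : ℕ, q.Prime → r.Prime → q ∣ Nat.card G → r ∣ Nat.card G → q = r)
    (hG : Nat.card G ≠ 1) : ∃ p t : ℕ, p.Prime ∧ p ∣ Nat.card G ∧ Nat.card G = p ^ t :=
  ⟨_, _, Nat.minFac_prime hG, Nat.minFac_dvd _,
    Nat.eq_prime_pow_of_unique_prime_dvd Nat.card_pos.ne' fun hd hdvd =>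
      h _ _ hd (Nat.minFac_prime hG) hdvd (Nat.minFac_dvd _)⟩

/-- An element of maximal order generates, and elements of distinct prime orders would be
incomparable. -/
theorem isCyclic_and_card_eq_pow_of_mem_zpowers_or
    (h : ∀ a b : G, a ∈ zpowers b ∨ b ∈ zpowers a) :
    IsCyclic G ∧ ∃ p t : ℕ, p.Prime ∧ Nat.card G = p ^ t := by
  constructor
  · obtain ⟨g, hg⟩ := Finite.exists_max (orderOf : G → ℕ)
    exact ⟨g, fun a => (h a g).elim id fun hga => mem_zpowers_of_orderOf_le hga (hg a)⟩
  · by_cases hG : Nat.card G = 1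
    · exact ⟨2, 0, Nat.prime_two, by simpa using hG⟩
    have hprime : ∀ q r : ℕ, q.Prime → r.Prime → q ∣ Nat.card G → r ∣ Nat.card G → q = r := by
      intro q r hq hr hqd hrd
      have := Fact.mk hq
      have := Fact.mk hr
      obtain ⟨a, ha⟩ := exists_prime_orderOf_dvd_card' q hqd
      obtain ⟨b, hb⟩ := exists_prime_orderOf_dvd_card' r hrd
      obtain hab | hab := h a b
      · exact (Nat.prime_dvd_prime_iff_eq hq hr).1 (ha ▸ hb ▸ orderOf_dvd_of_mem_zpowers hab)
      · exact ((Nat.prime_dvd_prime_iff_eq hr hq).1 (ha ▸ hb ▸ orderOf_dvd_of_mem_zpowers hab)).symm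
    obtain ⟨p, t, hp, -, ht⟩ := exists_prime_card_eq_pow hprime hG
    exact ⟨p, t, hp, ht⟩

end Cyclic

/-! ### Structure of the odd part, and the lower bound for connectivity. -/

namespace IsTwoDecomposition

variable {G : Type*} [Group G] [Fintype G] {P H : Subgroup G} {x : G}

/-- For `h` of maximal order in `H` the non-neighbours of `h` in `H` are exactly H \ ⟨h⟩. The cut
bound gives |H| - |⟨h⟩| < |⟨h⟩|, so ⟨h⟩ has index 1. -/
theorem isCyclic_right (d : IsTwoDecomposition P H)
    (hκ : Nat.card H ≤ vertexConnectivity (powerGraph G)) (hx : orderOf x = 2)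
    (hsq : ∀ y : G, y ^ 2 ≠ x) : IsCyclic H := by
  classical
  obtain ⟨⟨h, hh⟩, hmax⟩ := Finite.exists_max (fun k : H => orderOf (k : G))
  rw [Subgroup.isCyclic_iff_exists_zpowers_eq_top]
  refine ⟨h, ?_⟩
  by_contra hne
  have hle : zpowers h ≤ H := zpowers_le.2 hh
  have hcard := d.card_nonneighbors_le hκ hx hsq hh
  have h1 : Nat.card {u : G // u ∈ zpowers h ∧ h ∉ zpowers u} < orderOf h := by
    rw [← Nat.card_zpowers, Nat.card_eq_fintype_card, Nat.card_eq_fintype_card,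
      Fintype.card_subtype, Fintype.card_subtype]
    refine Finset.card_lt_card (Finset.ssubset_iff_subset_ne.2 ⟨fun u => by simp; tauto, ?_⟩)
    intro he
    have : h ∈ Finset.univ.filter (· ∈ zpowers h) := by simp
    rw [← he] at this
    simp at this
  have h2 : Nat.card H =
      Nat.card {k : G // k ∈ H ∧ k ∉ zpowers h ∧ h ∉ zpowers k} + orderOf h := by
    rw [← Nat.card_zpowers, Nat.card_eq_fintype_card, Nat.card_eq_fintype_card,
      Nat.card_eq_fintype_card, Fintype.card_subtype, Fintype.card_subtype, Fintype.card_subtype,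
      ← Finset.card_union_of_disjoint]
    · congr 1
      ext k
      have hk1 := @hle k
      have hk2 : k ∈ H → h ∈ zpowers k → k ∈ zpowers h := fun hk hm =>
        mem_zpowers_of_orderOf_le hm (hmax ⟨k, hk⟩)
      simp
      tauto
    · rw [Finset.disjoint_left]; intro k; simp; tauto
  obtain ⟨c, hc⟩ := Subgroup.card_dvd_of_le hle
  rw [Nat.card_zpowers] at hc
  have hc2 : 2 ≤ c := by
    by_contra! hlt
    interval_cases c
    · have := Nat.card_pos (α := H)
      omega
    · exact hne (Subgroup.eq_of_le_of_card_ge hle (by rw [Nat.card_zpowers]; omega))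
  have := Nat.mul_le_mul_left (orderOf h) hc2
  omega

/-- If `h` has prime order q, only 1 fails to generate ⟨h⟩, so `h` has at most one non-neighbour in
`H`. An element of another odd prime order and its inverse would be two. -/
theorem exists_odd_prime_card_right_eq_pow (d : IsTwoDecomposition P H)
    (hκ : Nat.card H ≤ vertexConnectivity (powerGraph G)) (hx : orderOf x = 2)
    (hsq : ∀ y : G, y ^ 2 ≠ x) : ∃ p t : ℕ, p.Prime ∧ Odd p ∧ Nat.card H = p ^ t := by
  classical
  by_cases hH : Nat.card H = 1
  -- For trivial `H` any odd prime serves.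
  · exact ⟨3, 0, Nat.prime_three, by decide, by simpa using hH⟩
  have hprime : ∀ q r : ℕ, q.Prime → r.Prime → q ∣ Nat.card H → r ∣ Nat.card H → q = r := by
    intro q r hq hr hqd hrd
    by_contra hqr
    have := Fact.mk hq
    have := Fact.mk hr
    obtain ⟨⟨h, hh⟩, hhq⟩ := exists_prime_orderOf_dvd_card' q hqd
    obtain ⟨⟨z, hz⟩, hzr⟩ := exists_prime_orderOf_dvd_card' r hrd
    rw [Subgroup.orderOf_mk] at hhq hzr
    have hcard := d.card_nonneighbors_le hκ hx hsq hh
    rw [Nat.card_eq_fintype_card, Nat.card_eq_fintype_card, Fintype.card_subtype,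
      Fintype.card_subtype] at hcard
    have h1 : (Finset.univ.filter fun u : G => u ∈ zpowers h ∧ h ∉ zpowers u).card ≤ 1 := by
      refine (Finset.card_le_card (t := {1}) fun u => ?_).trans (by simp)
      simp only [Finset.mem_filter, Finset.mem_univ, true_and, Finset.mem_singleton]
      rintro ⟨hu, hu'⟩
      obtain h1 | h1 := (Nat.dvd_prime hq).1 (hhq ▸ orderOf_dvd_of_mem_zpowers hu)
      · exact orderOf_eq_one_iff.1 h1
      · exact absurd (mem_zpowers_of_orderOf_le hu (by omega)) hu'
    have hmem : ∀ y ∈ H, orderOf y = r →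
        y ∈ Finset.univ.filter fun k : G => k ∈ H ∧ k ∉ zpowers h ∧ h ∉ zpowers k := by
      intro y hy hyr
      simp only [Finset.mem_filter, Finset.mem_univ, true_and]
      refine ⟨hy, fun hm => hqr ?_, fun hm => hqr ?_⟩
      · exact ((Nat.prime_dvd_prime_iff_eq hr hq).1
          (hyr ▸ hhq ▸ orderOf_dvd_of_mem_zpowers hm)).symm
      · exact (Nat.prime_dvd_prime_iff_eq hq hr).1 (hyr ▸ hhq ▸ orderOf_dvd_of_mem_zpowers hm)
    have h2 := Finset.one_lt_card.2 ⟨z, hmem z hz hzr, z⁻¹, hmem _ (inv_mem hz) (by simpa using hzr),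
      fun he => ?_⟩
    · omega
    · have hz2 : z ^ 2 = 1 := by rw [sq]; nth_rewrite 1 [he]; simp
      have hr2 := (Nat.prime_dvd_prime_iff_eq hr Nat.prime_two).1
        (hzr ▸ orderOf_dvd_of_pow_eq_one hz2)
      have := d.odd_orderOf hz
      rw [hzr, hr2] at this
      exact absurd this (by decide)
  obtain ⟨p, t, hp, hd, ht⟩ := exists_prime_card_eq_pow hprime hH
  exact ⟨p, t, hp, d.odd.of_dvd_nat hd, ht⟩

theorem natCard_le_vertexConnectivity (d : IsTwoDecomposition P H) (hx : orderOf x = 2)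
    (htot : ∀ c ∈ H, ∀ k ∈ H, c ∈ zpowers k ∨ k ∈ zpowers c) :
    Nat.card H ≤ vertexConnectivity (powerGraph G) := by
  classical
  have hxP := d.mem_left_of_orderOf_eq_two hx
  have hx1 : x ≠ 1 := by rintro rfl; simp at hx
  refine le_vertexConnectivity _ ?_ fun S hS => ?_
  · rw [← d.isComplement.card_mul_card]
    have : Nontrivial P := ⟨⟨x, hxP⟩, 1, fun h => hx1 (congrArg Subtype.val h)⟩
    have h1 := Finite.one_lt_card (α := P)
    exact lt_mul_of_one_lt_left Nat.card_pos h1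
  -- Otherwise every `h` in `H` has `h` or `a * h` in `S`; the odd coordinate recovers `h`, so |H| ≤
  -- |S|.
  · have hex : ∀ a ∈ P, ∃ h ∈ H, h ∉ S ∧ a * h ∉ S := by
      intro a ha
      by_contra! hcon
      have hsub : (Finset.univ.filter (· ∈ H)).card ≤ S.card := by
        refine Finset.card_le_card_of_injOn (fun h => if h ∈ S then h else a * h) ?_ ?_
        · intro h hh
          have hh : h ∈ H := by simpa using hh
          by_cases hhS : h ∈ S
          · simp [hhS]
          · simpa [hhS] using hcon h hh hhS
        · intro h hh k hk he
          have hh : h ∈ H := by simpa using hh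
          have hk : k ∈ H := by simpa using hk
          have hmul : ∀ b ∈ P, ∀ c ∈ P, b * h = c * k → h = k :=
            fun b hb c hc e => (d.mul_inj hb hc hh hk e).2
          dsimp only at he
          split_ifs at he
          · exact he
          · exact hmul 1 (one_mem P) a ha (by simpa using he)
          · exact hmul a ha 1 (one_mem P) (by simpa using he)
          · exact hmul a ha a ha he
      rw [Nat.card_eq_fintype_card, Fintype.card_subtype] at hS
      omega
    set Γ := (powerGraph G).induce ((S : Set G)ᶜ)
    have hreach : ∀ u v : ((S : Set G)ᶜ : Set G),
        ((u : G) ∈ zpowers (v : G) ∨ (v : G) ∈ zpowers (u : G)) → Γ.Reachable u v := by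
      intro u v h
      by_cases huv : u = v
      · rw [huv]
      · exact SimpleGraph.Adj.reachable
          (powerGraph_adj_iff.2 ⟨fun e => huv (Subtype.ext e), h⟩)
    obtain ⟨h₀, hh₀, hS₀, -⟩ := hex 1 (one_mem P)
    have hbase : ∀ u : ((S : Set G)ᶜ : Set G), Γ.Reachable u ⟨h₀, by simpa using hS₀⟩ := by
      rintro ⟨g, hg⟩
      obtain ⟨a, ha, c, hc, rfl⟩ := d.exists_mul_eq g
      obtain ⟨h, hh, hhS, hahS⟩ := hex a ha
      -- The route is a * c, a * h, h, h₀: the outer moves use the chain condition in `H`, the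
      -- middle one that `h` is a power of `a * h`.
      refine (hreach _ ⟨a * h, by simpa using hahS⟩ ?_).trans
        ((hreach _ ⟨h, by simpa using hhS⟩ ?_).trans (hreach _ _ (htot h hh h₀ hh₀)))
      · simp only [d.mul_mem_zpowers_mul_iff ha ha hc hh, d.mul_mem_zpowers_mul_iff ha ha hh hc,
          mem_zpowers, true_and]
        exact htot c hc h hh
      · refine Or.inr ?_
        have := (d.mul_mem_zpowers_mul_iff (one_mem P) ha hh hh).2 ⟨one_mem _, mem_zpowers h⟩
        rwa [one_mul] at this
    exact fun u v => (hbase u).trans (hbase v).symm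

theorem vertexConnectivity_eq_minDegree [DecidableRel (powerGraph G).Adj]
    (d : IsTwoDecomposition P H) (hx : orderOf x = 2) (hsq : ∀ y : G, y ^ 2 ≠ x) {p t : ℕ}
    (hp : p.Prime) (hcard : Nat.card H = p ^ t) (hH : IsCyclic H) :
    vertexConnectivity (powerGraph G) = (powerGraph G).minDegree := by
  refine le_antisymm (vertexConnectivity_le_minDegree _) ?_
  refine ((powerGraph G).minDegree_le_degree x).trans ?_
  rw [d.degree_eq_natCard hx hsq]
  refine d.natCard_le_vertexConnectivity hx fun c hc k hk => ?_
  have := mem_zpowers_or_mem_zpowers_of_card_eq_pow hp hcard ⟨c, hc⟩ ⟨k, hk⟩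
  simp only [mem_zpowers_iff, Subtype.ext_iff, Subgroup.coe_zpow] at this ⊢
  exact this

theorem card_right_eq_pow (d : IsTwoDecomposition P H) {p s t : ℕ} (hodd : Odd p)
    (hcard : Nat.card G = 2 ^ s * p ^ t) : Nat.card H = p ^ t := by
  obtain ⟨n, hn⟩ := d.isPGroup.exists_card_eq
  have hm := d.isComplement.card_mul_card
  rw [hcard, hn] at hm
  apply Nat.dvd_antisymm
  · exact ((Nat.coprime_two_right.2 d.odd).pow_right s).dvd_of_dvd_mul_left
      (hm ▸ dvd_mul_left _ _)
  · exact (((Nat.coprime_two_right.2 hodd).pow_left t).pow_right n).dvd_of_dvd_mul_left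
      (hm ▸ dvd_mul_left _ _)

end IsTwoDecomposition

/-! ### Assembly of the equivalence. -/

theorem exists_isTwoDecomposition {G : Type*} [Group G] [Finite G] [Group.IsNilpotent G]
    (h2 : 2 ∣ Nat.card G) (P : Sylow 2 G) :
    ∃ H : Subgroup G, IsTwoDecomposition (P : Subgroup G) H := by
  obtain ⟨H, hodd, hc, hcomm⟩ := exists_odd_complement_sylow_two h2 P
  exact ⟨H, P.isPGroup', hodd, hc, hcomm⟩

theorem vertexConnectivity_eq_minDegree_of_card_eq_pow {G : Type*} [Group G] [Fintype G]
    [IsCyclic G] [DecidableRel (powerGraph G).Adj] {p n : ℕ} (hp : p.Prime)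
    (h : Nat.card G = p ^ n) :
    vertexConnectivity (powerGraph G) = (powerGraph G).minDegree := by
  refine le_antisymm (vertexConnectivity_le_minDegree _) (le_vertexConnectivity _ ?_ ?_)
  · rw [Nat.card_eq_fintype_card]
    exact SimpleGraph.minDegree_lt_card _
  · intro S _ u v
    by_cases huv : u = v
    · rw [huv]
    · exact SimpleGraph.Adj.reachable (powerGraph_adj_iff.2 ⟨fun e => huv (Subtype.ext e),
        mem_zpowers_or_mem_zpowers_of_card_eq_pow hp h _ _⟩)

theorem theorem1p4 (G : Type*) [Group G] [Fintype G] [Group.IsNilpotent G]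
    [DecidableRel (powerGraph G).Adj] :
    vertexConnectivity (powerGraph G) = (powerGraph G).minDegree ↔
      (IsCyclic G ∧ ∃ p a : ℕ, p.Prime ∧ (Nat.card G = p ^ a ∨ Nat.card G = 2 * p ^ a)) ∨
      (¬ IsCyclic G ∧ ∃ p s t : ℕ, p.Prime ∧ Odd p ∧ 2 ≤ s ∧ Nat.card G = 2 ^ s * p ^ t ∧
        (∀ P : Sylow 2 G, ¬ IsCyclic P ∧
          ∃ M : Subgroup P, IsMaximalCyclic M ∧ Nat.card M = 2) ∧
        (∀ Q : Sylow p G, IsCyclic Q)) := by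
  constructor
  · intro hκ
    obtain ⟨x, hxmin⟩ := (powerGraph G).exists_minimal_degree_vertex
    by_cases hdom : ∃ w, w ≠ x ∧ ¬ (powerGraph G).Adj x w
    swap
    -- A dominating vertex of minimum degree forces every degree to be |G| - 1.
    · push Not at hdom
      have hdeg : Fintype.card G - 1 ≤ (powerGraph G).minDegree := by
        classical
        rw [hxmin, ← SimpleGraph.card_neighborFinset_eq_degree, ← Finset.card_univ,
          ← Finset.card_erase_of_mem (Finset.mem_univ x)]
        exact Finset.card_le_card fun w hw => by simpa using hdom w (Finset.ne_of_mem_erase hw)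
      have htot : ∀ a b : G, a ∈ zpowers b ∨ b ∈ zpowers a := by
        classical
        intro a b
        by_cases hab : a = b
        · simp [hab]
        · have h1 := hdeg.trans ((powerGraph G).minDegree_le_degree a)
          have h2 : (powerGraph G).neighborFinset a = Finset.univ.erase a := by
            refine Finset.eq_of_subset_of_card_le (fun w hw => ?_) ?_
            · rw [SimpleGraph.mem_neighborFinset] at hw
              simpa using hw.ne'
            · rw [Finset.card_erase_of_mem (Finset.mem_univ a), Finset.card_univ]
              exact h1
          have h3 : b ∈ (powerGraph G).neighborFinset a := by rw [h2]; simp [Ne.symm hab]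
          rw [SimpleGraph.mem_neighborFinset] at h3
          exact (powerGraph_adj_iff.1 h3).2
      obtain ⟨hc, p, t, hp, ht⟩ := isCyclic_and_card_eq_pow_of_mem_zpowers_or htot
      exact Or.inl ⟨hc, p, t, hp, Or.inl ht⟩
    obtain ⟨w, hwx, hw⟩ := hdom
    have hx := orderOf_eq_two_of_degree_le hκ hxmin.ge hwx hw
    have hsq := sq_ne_of_degree_le hκ hxmin.ge hwx hw
    have h2 : 2 ∣ Nat.card G := hx ▸ orderOf_dvd_natCard x
    have hlow : ∀ {P H : Subgroup G}, IsTwoDecomposition P H →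
        Nat.card H ≤ vertexConnectivity (powerGraph G) := fun d => by
      rw [hκ, hxmin, d.degree_eq_natCard hx hsq]
    obtain ⟨P₀⟩ : Nonempty (Sylow 2 G) := inferInstance
    obtain ⟨H, d⟩ := exists_isTwoDecomposition h2 P₀
    obtain ⟨p, t, hp, hodd, ht⟩ := d.exists_odd_prime_card_right_eq_pow (hlow d) hx hsq
    have hH := d.isCyclic_right (hlow d) hx hsq
    have hcard := d.isComplement.card_mul_card
    by_cases hG : IsCyclic G
    · refine Or.inl ⟨hG, p, t, hp, Or.inr ?_⟩
      obtain ⟨b, hb⟩ := (Subgroup.isCyclic_iff_exists_zpowers_eq_top (P₀ : Subgroup G)).1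
        inferInstance
      have hxb : x ∈ zpowers b := hb ▸ d.mem_left_of_orderOf_eq_two hx
      -- The generator of the cyclic Sylow 2-subgroup has the nonsquare involution as a power, hence
      -- equals it.
      have hbx := d.eq_of_mem_zpowers hx hsq (hb ▸ mem_zpowers b) hxb
      rw [← hcard, ht, ← hb, Nat.card_zpowers, hbx, hx]
    · obtain ⟨s, hs⟩ := d.isPGroup.exists_card_eq
      have hP₀ : ¬ IsCyclic (P₀ : Subgroup G) := fun h => hG (d.isCyclic h hH)
      refine Or.inr ⟨hG, p, s, t, hp, hodd, ?_, by rw [← hcard, hs, ht], fun P => ?_, fun Q => ?_⟩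
      · by_contra! hlt
        interval_cases s
        · have := (Nat.card_eq_one_iff_unique.1 hs).1
          exact hP₀ inferInstance
        · exact hP₀ (isCyclic_of_prime_card (p := 2) hs)
      · obtain ⟨K, d'⟩ := exists_isTwoDecomposition h2 P
        have hxP := d'.mem_left_of_orderOf_eq_two hx
        refine ⟨fun h => hG (d'.isCyclic h (d'.isCyclic_right (hlow d') hx hsq)),
          zpowers ⟨x, hxP⟩, ⟨inferInstance, fun N hN hlt => ?_⟩, ?_⟩
        · obtain ⟨y, rfl⟩ := (Subgroup.isCyclic_iff_exists_zpowers_eq_top N).1 hN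
          have hxy : (⟨x, hxP⟩ : P) ∈ zpowers y := zpowers_le.1 hlt.le
          have hxy' : x ∈ zpowers (y : G) := by
            obtain ⟨k, hk⟩ := hxy
            exact ⟨k, congrArg Subtype.val hk⟩
          have hyx : y = ⟨x, hxP⟩ := Subtype.ext (d'.eq_of_mem_zpowers hx hsq y.2 hxy')
          exact hlt.ne (by rw [hyx])
        · rw [Nat.card_zpowers, Subgroup.orderOf_mk, hx]
      · have hQH : (Q : Subgroup G) ≤ H := by
          intro g hg
          obtain ⟨k, hk⟩ := Q.isPGroup' ⟨g, hg⟩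
          exact d.mem_right_of_pow_eq_one (hodd.pow (n := k)) (congrArg Subtype.val hk)
        exact isCyclic_of_injective (Subgroup.inclusion hQH) (Subgroup.inclusion_injective hQH)
  · rintro (⟨hG, p, a, hp, hcard | hcard⟩ | ⟨-, p, s, t, hp, hodd, hs, hcard, hP, hQ⟩)
    · exact vertexConnectivity_eq_minDegree_of_card_eq_pow hp hcard
    · obtain rfl | hodd := hp.eq_two_or_odd'
      · exact vertexConnectivity_eq_minDegree_of_card_eq_pow hp
          (n := a + 1) (by rw [hcard, pow_succ'])
      have h2 : 2 ∣ Nat.card G := hcard ▸ dvd_mul_right _ _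
      obtain ⟨x, hx⟩ := exists_prime_orderOf_dvd_card' 2 h2
      obtain ⟨P⟩ : Nonempty (Sylow 2 G) := inferInstance
      obtain ⟨H, d⟩ := exists_isTwoDecomposition h2 P
      refine d.vertexConnectivity_eq_minDegree hx ?_ hp
        (d.card_right_eq_pow (s := 1) hodd (by rw [hcard, pow_one])) inferInstance
      -- A square root of the involution would have order 4, which does not divide 2 * p ^ a for odd
      -- `p`.
      rintro y rfl
      have hy : orderOf y = 4 := orderOf_eq_prime_pow (p := 2) (n := 1)
        (fun h => by rw [pow_one] at h; rw [h, orderOf_one] at hx; omega)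
        (by rw [pow_succ, pow_one, pow_mul, ← orderOf_dvd_iff_pow_eq_one, hx])
      have h4 : 2 * 2 ∣ 2 * p ^ a := by
        rw [← hcard, show 2 * 2 = orderOf y from hy.symm]
        exact orderOf_dvd_natCard y
      have := (Nat.mul_dvd_mul_iff_left two_pos).1 h4
      exact Nat.not_even_iff_odd.2 (hodd.pow (n := a)) (even_iff_two_dvd.2 this)
    · have h2 : 2 ∣ Nat.card G := hcard ▸ (dvd_pow_self 2 (by omega)).mul_right _
      obtain ⟨P⟩ : Nonempty (Sylow 2 G) := inferInstance
      obtain ⟨H, d⟩ := exists_isTwoDecomposition h2 P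
      obtain ⟨-, M, ⟨hMc, hMmax⟩, hM⟩ := hP P
      obtain ⟨x, rfl⟩ := (Subgroup.isCyclic_iff_exists_zpowers_eq_top M).1 hMc
      rw [Nat.card_zpowers] at hM
      have hH := d.card_right_eq_pow hodd hcard
      have := Fact.mk hp
      obtain ⟨Q, hHQ⟩ := (IsPGroup.of_card hH).exists_le_sylow
      have := hQ Q
      refine d.vertexConnectivity_eq_minDegree (x := (x : G)) (by simpa using hM) ?_ hp hH
        (isCyclic_of_injective (Subgroup.inclusion hHQ) (Subgroup.inclusion_injective hHQ))
      -- A square root `y` would lie in `P` and generate a cyclic subgroup properly containing the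
      -- maximal one.
      intro y hy
      have hyP : y ∈ P := d.mem_left_of_pow_eq_one (k := 2) (by
        rw [pow_succ, pow_one, pow_mul, hy, ← orderOf_dvd_iff_pow_eq_one, Subgroup.orderOf_coe, hM])
      have hyx : (⟨y, hyP⟩ : P) ^ 2 = x := Subtype.ext hy
      refine hMmax (zpowers ⟨y, hyP⟩) inferInstance (lt_of_le_of_ne ?_ fun he => ?_)
      · rw [zpowers_le, ← hyx]
        exact npow_mem_zpowers _ 2
      · have h1 := congrArg (fun K : Subgroup P => Nat.card K) he
        simp only [Nat.card_zpowers, hM] at h1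
        have h3 : x = 1 := by exact hyx.symm.trans (orderOf_dvd_iff_pow_eq_one.1 h1.symm.dvd)
        rw [h3, orderOf_one] at hM
        omega
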